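/- Let $\alpha\in\mathbb{C}\setminus\mathbb{R}$ be a root of $x^3-2x^2+x-1$. Let $$\mathcal{R}_2=\Big\{\sum_{i=2}^{\infty}\varepsilon_i\alpha^i \;:\; \varepsilon_i\in\{0,1\}\text{ and }\varepsilon_i\varepsilon_{i-1}\varepsilon_{i-2}\varepsilon_{i-3}<_{lex}1101\ \text{ for all } i\ge 2\Big\},$$ where $\varepsilon_1=\varepsilon_0=\varepsilon_{-1}=0$ and $<_{lex}$ is the lexicographic order on words. For $v\in\mathbb{C}$ put $\mathcal{R}_v=\mathcal{R}_2\cap(\mathcal{R}_2+v)$ (for $v=\alpha-1$ and $v=\alpha^{-2}+1$ below). For $z\in\mathbb{C}$ define $$g(z)=\alpha-1+\alpha z,\quad h_0(z)=\alpha-1+\alpha^2z,\quad h_1(z)=-1+\alpha^3z,\quad h_2(z)=\alpha^2+\alpha^3+\alpha^4z.$$ Then $h_0,h_1,h_2$ are contractions of $\mathbb{C}$, and: (a) $\mathcal{R}_{\alpha-1}=g(\mathcal{R}_{\alpha^{-2}+1})$; (b) $\mathcal{R}_{\alpha-1}=h_0(\mathcal{R}_{\alpha-1})\cup h_1(\mathcal{R}_{\alpha-1})\cup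 h_2(\mathcal{R}_{\alpha-1})$; (c) $h_1(\mathcal{R}_{\alpha-1})\cap h_2(\mathcal{R}_{\alpha-1})=\{-1-\alpha^2-\alpha^4\}=\{h_2(-\alpha-\alpha^{-1})\}$; (d) $h_1(\mathcal{R}_{\alpha-1})\cap h_0(\mathcal{R}_{\alpha-1})=\{-1-\alpha^3\}=\{h_1(-1)\}$; (e) $h_0(\mathcal{R}_{\alpha-1})\cap h_2(\mathcal{R}_{\alpha-1})=\emptyset$. -/

import Mathlib

/-- `ε` is an admissible digit sequence for the base-`a` expansion: it vanishes at all indices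
below `2`, all digits are in `{0, …, a - 1}`, and every window `ε i, ε (i-1), ε (i-2), ε (i-3)`
is lexicographically smaller than the word `(a-1)(a-1)01` (`<` on lists is the lexicographic
order). Meant for `2 ≤ a`. -/
def IsAdmissible (a : ℕ) (ε : ℤ → ℕ) : Prop :=
  (∀ i : ℤ, i < 2 → ε i = 0) ∧
  ∀ i : ℤ, 2 ≤ i → ε i < a ∧ [ε i, ε (i - 1), ε (i - 2), ε (i - 3)] < [a - 1, a - 1, 0, 1]

/-- The Rauzy fractal `ℛ_a`: all sums `∑_{i ≥ 2} ε_i α^i` over admissible digit sequences. -/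
def rauzyFractal (a : ℕ) (α : ℂ) : Set ℂ :=
  {z | ∃ ε : ℤ → ℕ, IsAdmissible a ε ∧
    HasSum (fun n : ℕ => (ε ((n : ℤ) + 2) : ℂ) * α ^ (n + 2)) z}

/-- `ℛ_v = ℛ_2 ∩ (ℛ_2 + v)`. -/
def rauzyRegion (α v : ℂ) : Set ℂ :=
  rauzyFractal 2 α ∩ (fun z => z + v) '' rauzyFractal 2 α

/-- `g(z) = α - 1 + α z`. -/
def mapG (α z : ℂ) : ℂ := α - 1 + α * z

/-- `h₀(z) = α - 1 + α² z`. -/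
def mapH0 (α z : ℂ) : ℂ := α - 1 + α ^ 2 * z

/-- `h₁(z) = -1 + α³ z`. -/
def mapH1 (α z : ℂ) : ℂ := -1 + α ^ 3 * z

/-- `h₂(z) = α² + α³ + α⁴ z`. -/
def mapH2 (α z : ℂ) : ℂ := α ^ 2 + α ^ 3 + α ^ 4 * z

/-! Points of `ℛ₂` are `α² Σ eₙ αⁿ` with `e` a binary sequence avoiding `111` and `1011`. A point of
`ℛ_v` is therefore a pair of such sequences `e`, `f` whose values differ by `v/α²`, which is `2 - α`
for `v = α - 1` and `2α - α²` for `v = α⁻² + 1`. Reading one digit from each sequence and dividing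
by `α` keeps the difference in `ℤ[α]`. A difference of two values has modulus at most `1/(1 - |α|) <
4.08`, so most branches of the digit tree die. A finite search, sound by `jointWord_mem_prefixes`,
then lists the possible beginnings of `(e, f)`. For `2 - α` the beginnings (`prefix_cases_two_sub`)
either return to `±(2 - α)`, which gives `h₀`, `h₁`, `h₂`, or reach `±(-2 + 3α - α²)`. The latter
difference repeats with period four and determines its point (`digitSum_of_lattice_X`). A point
common to two pieces has two expansions, hence a further difference to search. This is contradictory
for `h₀`, `h₂`. For the other two pairs it forces a rotation of `1100 1100 …`, so a single point by
contraction (`digitSum_eq_of_selfSimilar`). -/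

/-! ### Binary digit sequences and their values -/

/-- Four consecutive digits (in order of increasing index) contain neither `111` nor `1011`. -/
def windowOk (a b c d : Bool) : Bool :=
  !(a && b && c) && !(b && c && d) && !(a && !b && c && d)

/-- Binary sequences avoiding the factors `111` and `1011`. -/
def Avoiding (e : ℕ → Bool) : Prop :=
  ∀ n, windowOk (e n) (e (n + 1)) (e (n + 2)) (e (n + 3)) = true

/-- Prepend a digit. -/
def consDigit (b : Bool) (e : ℕ → Bool) : ℕ → Bool
  | 0 => b
  | n + 1 => e n

/-- Drop the first digit. -/
def tailDigits (e : ℕ → Bool) : ℕ → Bool := fun n => e (n + 1)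

/-- The complex number `0` or `1` given by a digit. -/
def digitVal (b : Bool) : ℂ := if b then 1 else 0

/-- The value `∑ eₙ αⁿ`. -/
noncomputable def digitSum (α : ℂ) (e : ℕ → Bool) : ℂ := ∑' n, digitVal (e n) * α ^ n

@[simp] theorem consDigit_zero (b : Bool) (e : ℕ → Bool) : consDigit b e 0 = b := rfl
@[simp] theorem consDigit_one (b : Bool) (e : ℕ → Bool) : consDigit b e 1 = e 0 := rfl
@[simp] theorem consDigit_two (b : Bool) (e : ℕ → Bool) : consDigit b e 2 = e 1 := rfl
@[simp] theorem tailDigits_apply (e : ℕ → Bool) (n : ℕ) : tailDigits e n = e (n + 1) := rfl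
@[simp] theorem tailDigits_consDigit (b : Bool) (e : ℕ → Bool) :
    tailDigits (consDigit b e) = e := rfl
theorem consDigit_tailDigits (e : ℕ → Bool) : consDigit (e 0) (tailDigits e) = e := by
  funext n; cases n <;> rfl
@[simp] theorem digitVal_true : digitVal true = 1 := rfl
@[simp] theorem digitVal_false : digitVal false = 0 := rfl

theorem norm_digitVal_le (b : Bool) : ‖digitVal b‖ ≤ 1 := by cases b <;> simp

theorem norm_digitVal_sub_le (a b : Bool) : ‖digitVal a - digitVal b‖ ≤ 1 := by
  cases a <;> cases b <;> simp

theorem Avoiding.tail {e : ℕ → Bool} (h : Avoiding e) : Avoiding (tailDigits e) :=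
  fun n => h (n + 1)

theorem Avoiding.cons {e : ℕ → Bool} (h : Avoiding e) {b : Bool}
    (hb : windowOk b (e 0) (e 1) (e 2) = true) : Avoiding (consDigit b e) := by
  intro n
  cases n with
  | zero => exact hb
  | succ n => exact h n

theorem Avoiding.cons_false {e : ℕ → Bool} (h : Avoiding e) :
    Avoiding (consDigit false e) := by
  refine h.cons ?_
  have := h 0
  revert this
  simp only [windowOk, zero_add]
  cases e 0 <;> cases e 1 <;> cases e 2 <;> simp

section

variable {α : ℂ}

theorem summable_digits (h : ‖α‖ < 1) (e : ℕ → Bool) :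
    Summable fun n => digitVal (e n) * α ^ n := by
  refine Summable.of_norm_bounded (summable_geometric_of_lt_one (norm_nonneg α) h) fun n => ?_
  rw [norm_mul, norm_pow]
  exact mul_le_of_le_one_left (by positivity) (norm_digitVal_le _)

theorem digitSum_eq (h : ‖α‖ < 1) (e : ℕ → Bool) :
    digitSum α e = digitVal (e 0) + α * digitSum α (tailDigits e) := by
  rw [digitSum, (summable_digits h e).tsum_eq_zero_add, digitSum, ← tsum_mul_left]
  simp only [pow_zero, mul_one, tailDigits_apply]
  congr 1
  exact tsum_congr fun n => by ring

theorem digitSum_cons (h : ‖α‖ < 1) (b : Bool) (e : ℕ → Bool) :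
    digitSum α (consDigit b e) = digitVal b + α * digitSum α e := by
  rw [digitSum_eq h, consDigit_zero, tailDigits_consDigit]

theorem norm_digitSum_sub_le (h : ‖α‖ < 1) (e f : ℕ → Bool) :
    ‖digitSum α e - digitSum α f‖ ≤ (1 - ‖α‖)⁻¹ := by
  rw [digitSum, digitSum, ← (summable_digits h e).tsum_sub (summable_digits h f)]
  refine tsum_of_norm_bounded (hasSum_geometric_of_lt_one (norm_nonneg α) h) fun n => ?_
  rw [← sub_mul, norm_mul, norm_pow]
  exact mul_le_of_le_one_left (by positivity) (norm_digitVal_sub_le _ _)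

theorem norm_digitSum_le (h : ‖α‖ < 1) (e : ℕ → Bool) :
    ‖digitSum α e‖ ≤ (1 - ‖α‖)⁻¹ := by
  refine tsum_of_norm_bounded (hasSum_geometric_of_lt_one (norm_nonneg α) h) fun n => ?_
  rw [norm_mul, norm_pow]
  exact mul_le_of_le_one_left (by positivity) (norm_digitVal_le _)

/-- A family of sequences closed under an affine rescaling of its values by `α ^ 4` about `c`
takes only the value `c`. -/
theorem digitSum_eq_of_selfSimilar (h : ‖α‖ < 1) {P : (ℕ → Bool) → Prop} {c : ℂ}
    (hP : ∀ e, P e → ∃ e', P e' ∧ digitSum α e - c = α ^ 4 * (digitSum α e' - c))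
    {e : ℕ → Bool} (he : P e) : digitSum α e = c := by
  -- Each use of `hP` gains a factor `|α|⁴` over a bound uniform in the sequence.
  have key : ∀ n : ℕ, ∀ e, P e →
      ‖digitSum α e - c‖ ≤ (‖α‖ ^ 4) ^ n * ((1 - ‖α‖)⁻¹ + ‖c‖) := by
    intro n
    induction n with
    | zero =>
      intro e _
      rw [pow_zero, one_mul]
      exact (norm_sub_le _ _).trans (by gcongr; exact norm_digitSum_le h e)
    | succ n ih =>
      intro e he
      obtain ⟨e', he', heq⟩ := hP e he
      rw [heq, norm_mul, norm_pow, pow_succ' (‖α‖ ^ 4) n, mul_assoc]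
      gcongr
      exact ih e' he'
  have lim : Filter.Tendsto (fun n : ℕ => (‖α‖ ^ 4) ^ n * ((1 - ‖α‖)⁻¹ + ‖c‖))
      Filter.atTop (nhds 0) := by
    simpa using (tendsto_pow_atTop_nhds_zero_of_lt_one (by positivity)
      (pow_lt_one₀ (norm_nonneg α) h (by norm_num : (4 : ℕ) ≠ 0))).mul_const
        ((1 - ‖α‖)⁻¹ + ‖c‖)
  have := ge_of_tendsto' lim fun n => key n e he
  exact sub_eq_zero.1 (norm_le_zero_iff.1 this)

end

/-! ### Admissibility as avoidance of two factors -/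

/-- The binary words not below `1101` are `1101`, `1110` and `1111`. -/
theorem lex_lt_iff {a b c d : ℕ} (ha : a < 2) (hb : b < 2) (hc : c < 2) (hd : d < 2) :
    [a, b, c, d] < [1, 1, 0, 1] ↔
      ¬(a = 1 ∧ b = 1 ∧ c = 1) ∧ ¬(a = 1 ∧ b = 1 ∧ c = 0 ∧ d = 1) := by
  interval_cases a <;> interval_cases b <;> interval_cases c <;> interval_cases d <;> decide

theorem isAdmissible_two_iff {ε : ℤ → ℕ} :
    IsAdmissible 2 ε ↔ (∀ i < 2, ε i = 0) ∧ (∀ i, ε i < 2) ∧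
      ∀ i, ¬(ε i = 1 ∧ ε (i - 1) = 1 ∧ ε (i - 2) = 1) ∧
        ¬(ε i = 1 ∧ ε (i - 1) = 1 ∧ ε (i - 2) = 0 ∧ ε (i - 3) = 1) := by
  constructor
  · rintro ⟨h0, h⟩
    have hlt : ∀ i, ε i < 2 := fun i => by
      rcases lt_or_ge i 2 with hi | hi
      · simp [h0 i hi]
      · exact (h i hi).1
    refine ⟨h0, hlt, fun i => ?_⟩
    rcases lt_or_ge i 2 with hi | hi
    · simp [h0 i hi]
    · exact (lex_lt_iff (hlt _) (hlt _) (hlt _) (hlt _)).1 (h i hi).2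
  · rintro ⟨h0, hlt, h⟩
    exact ⟨h0, fun i _ => ⟨hlt i,
      (lex_lt_iff (hlt _) (hlt _) (hlt _) (hlt _)).2 (h i)⟩⟩

theorem windowOk_iff {a b c d : Bool} : windowOk a b c d = true ↔
    ¬(a = true ∧ b = true ∧ c = true) ∧ ¬(b = true ∧ c = true ∧ d = true) ∧
      ¬(a = true ∧ b = false ∧ c = true ∧ d = true) := by
  revert a b c d; decide

theorem digitVal_decide {k : ℕ} (hk : k < 2) : digitVal (decide (k = 1)) = (k : ℂ) := by
  interval_cases k <;> simp

theorem mem_rauzyFractal_iff {α z : ℂ} (h : ‖α‖ < 1) :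
    z ∈ rauzyFractal 2 α ↔ ∃ e, Avoiding e ∧ z = α ^ 2 * digitSum α e := by
  constructor
  · rintro ⟨ε, hε, hz⟩
    obtain ⟨-, hlt, hw⟩ := isAdmissible_two_iff.1 hε
    refine ⟨fun n => decide (ε ((n : ℤ) + 2) = 1), fun n => ?_, ?_⟩
    · rw [windowOk_iff]
      -- Admissibility reads indices downwards: the window at `n + 4` excludes `111` in the first
      -- three digits, the one at `n + 5` the other two patterns.
      have h1 := hw ((n : ℤ) + 4)
      have h2 := hw ((n : ℤ) + 5)
      have e1 : (n : ℤ) + 4 - 1 = n + 3 := by ring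
      have e2 : (n : ℤ) + 4 - 2 = n + 2 := by ring
      have e4 : (n : ℤ) + 5 - 1 = n + 4 := by ring
      have e5 : (n : ℤ) + 5 - 2 = n + 3 := by ring
      have e6 : (n : ℤ) + 5 - 3 = n + 2 := by ring
      rw [e1, e2] at h1
      rw [e4, e5, e6] at h2
      have t3 := hlt ((n : ℤ) + 3)
      have c1 : ((n + 1 : ℕ) : ℤ) + 2 = n + 3 := by push_cast; ring
      have c2 : ((n + 2 : ℕ) : ℤ) + 2 = n + 4 := by push_cast; ring
      have c3 : ((n + 3 : ℕ) : ℤ) + 2 = n + 5 := by push_cast; ring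
      simp only [c1, c2, c3, decide_eq_true_eq, decide_eq_false_iff_not]
      omega
    · rw [digitSum, ← tsum_mul_left, ← hz.tsum_eq]
      refine tsum_congr fun n => ?_
      rw [digitVal_decide (hlt _)]
      ring
  · rintro ⟨e, he, rfl⟩
    refine ⟨fun i => if i < 2 then 0 else (e (i - 2).toNat).toNat, ?_, ?_⟩
    · refine isAdmissible_two_iff.2 ⟨fun i hi => by simp [hi], fun i => ?_, fun i => ?_⟩
      · split_ifs
        · norm_num
        · exact Bool.toNat_lt _
      -- Windows reaching below index `2` meet padding zeros: for `i < 4` no pattern fits, for `i =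
      -- 4` only `111` could.
      · rcases lt_or_ge i 4 with hi | hi
        · simp [show i - 2 < 2 by omega, show i - 3 < 2 by omega]
        · rcases lt_or_ge i 5 with hi5 | hi5
          · obtain rfl : i = 4 := by omega
            have := windowOk_iff.1 (he 0)
            simp at this ⊢
            revert this
            cases e 0 <;> cases e 1 <;> cases e 2 <;> simp
          · obtain ⟨n, rfl⟩ : ∃ n : ℕ, i = n + 5 := ⟨(i - 5).toNat, by omega⟩
            have hw := windowOk_iff.1 (he n)
            have c0 : ¬ ((n : ℤ) + 5 < 2) := by omega
            have c1 : ¬ ((n : ℤ) + 5 - 1 < 2) := by omega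
            have c2 : ¬ ((n : ℤ) + 5 - 2 < 2) := by omega
            have c3 : ¬ ((n : ℤ) + 5 - 3 < 2) := by omega
            have d0 : ((n : ℤ) + 5 - 2).toNat = n + 3 := by omega
            have d1 : ((n : ℤ) + 5 - 1 - 2).toNat = n + 2 := by omega
            have d2 : ((n : ℤ) + 5 - 2 - 2).toNat = n + 1 := by omega
            have d3 : ((n : ℤ) + 5 - 3 - 2).toNat = n := by omega
            simp only [c0, c1, c2, c3, if_false, d0, d1, d2, d3, Bool.toNat_eq_one,
              Bool.toNat_eq_zero]
            tauto
    · have hs := (summable_digits h e).hasSum.mul_left (α ^ 2)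
      rw [show (∑' n, digitVal (e n) * α ^ n) = digitSum α e from rfl] at hs
      refine Eq.mp (congrArg (HasSum · _) (funext fun n => ?_)) hs
      have c : ¬ ((n : ℤ) + 2 < 2) := by omega
      have d : ((n : ℤ) + 2 - 2).toNat = n := by omega
      simp only [c, if_false, d]
      cases e n <;> simp [pow_add, mul_comm]

/-! ### Numerical bounds on the modulus of the root -/

theorem im_sq_of_root {α : ℂ} (hα : α ^ 3 - 2 * α ^ 2 + α - 1 = 0) (hαim : α.im ≠ 0) :
    α.im ^ 2 = 3 * α.re ^ 2 - 4 * α.re + 1 := by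
  have h := congrArg Complex.im hα
  simp [pow_succ] at h
  apply mul_left_cancel₀ hαim
  linear_combination -h

theorem re_cubic_of_root {α : ℂ} (hα : α ^ 3 - 2 * α ^ 2 + α - 1 = 0) (hαim : α.im ≠ 0) :
    8 * α.re ^ 3 - 16 * α.re ^ 2 + 10 * α.re - 1 = 0 := by
  have h := congrArg Complex.re hα
  have h2 := im_sq_of_root hα hαim
  simp [pow_succ] at h
  linear_combination -h + (2 - 3 * α.re) * h2

theorem normSq_of_root {α : ℂ} (hα : α ^ 3 - 2 * α ^ 2 + α - 1 = 0) (hαim : α.im ≠ 0) :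
    Complex.normSq α = (1 - 2 * α.re) ^ 2 := by
  rw [Complex.normSq_apply]
  linear_combination im_sq_of_root hα hαim

/-- The three roots have product `1`, so `|α|²` is the inverse of the real root. -/
theorem normSq_cubic_of_root {α : ℂ} (hα : α ^ 3 - 2 * α ^ 2 + α - 1 = 0) (hαim : α.im ≠ 0) :
   
    Complex.normSq α ^ 3 - Complex.normSq α ^ 2 + 2 * Complex.normSq α - 1 = 0 := by
  rw [normSq_of_root hα hαim]
  have h := re_cubic_of_root hα hαim
  linear_combination (8 * α.re ^ 3 - 8 * α.re ^ 2 + 2 * α.re - 1) * h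

theorem normSq_lower {α : ℂ} (hα : α ^ 3 - 2 * α ^ 2 + α - 1 = 0) (hαim : α.im ≠ 0) :
    0.56984 < Complex.normSq α := by
  have h := normSq_cubic_of_root hα hαim
  by_contra! hn
  nlinarith [sq_nonneg (Complex.normSq α - 0.3), sq_nonneg (Complex.normSq α),
    Complex.normSq_nonneg α]

theorem normSq_upper {α : ℂ} (hα : α ^ 3 - 2 * α ^ 2 + α - 1 = 0) (hαim : α.im ≠ 0) :
    Complex.normSq α < 0.569841 := by
  have h := normSq_cubic_of_root hα hαim
  by_contra! hn
  nlinarith [sq_nonneg (Complex.normSq α - 0.3), sq_nonneg (Complex.normSq α),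
    Complex.normSq_nonneg α]

theorem norm_upper {α : ℂ} (hα : α ^ 3 - 2 * α ^ 2 + α - 1 = 0) (hαim : α.im ≠ 0) :
    ‖α‖ < 0.75488 := by
  have h := normSq_upper hα hαim
  rw [Complex.normSq_eq_norm_sq] at h
  nlinarith [norm_nonneg α]

theorem norm_lt_one_of_root {α : ℂ} (hα : α ^ 3 - 2 * α ^ 2 + α - 1 = 0) (hαim : α.im ≠ 0) :
    ‖α‖ < 1 := (norm_upper hα hαim).trans (by norm_num)

theorem ne_zero_of_root {α : ℂ}
    (hα : α ^ 3 - 2 * α ^ 2 + α - 1 = 0) :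
    α ≠ 0 := by
  rintro rfl
  norm_num at hα

/-! ### Finite search over differences in `ℤ[α]` -/

/-- The lattice point `p + q α + r α²`. -/
def latticeVal (α : ℂ) (s : ℤ × ℤ × ℤ) : ℂ := s.1 + s.2.1 * α + s.2.2 * α ^ 2

/-- The difference `(s - a + b) / α` remaining after the first digits `a`, `b`. -/
def nextState (s : ℤ × ℤ × ℤ) (a b : Bool) : ℤ × ℤ × ℤ :=
  let p := s.1 - a.toNat + b.toNat
  -- Uses `1/α = α² - 2α + 1`.
  (p + s.2.1, s.2.2 - 2 * p, p)

/-- A test which certifies that the lattice point `s` is not a difference of two digit sums. -/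
def tooBig (s : ℤ × ℤ × ℤ) : Bool :=
  let A := s.1 ^ 2 - s.1 * s.2.2 - s.2.1 * s.2.2
  let B := s.2.1 ^ 2 + s.1 * s.2.1 + s.1 * s.2.2 + 2 * s.2.1 * s.2.2
  let C := s.2.2 ^ 2 - s.1 * s.2.1 - 2 * s.1 * s.2.2
  decide (16680000 < A * 1000000 + (if 0 ≤ B then B * 569840 else B * 569841) +
    (if 0 ≤ C then C * 324717 else C * 324719))

/-- The three preceding digits, most recent first. -/
abbrev History := Bool × Bool × Bool

/-- Append a digit to a history. -/
def History.push (h : History) (a : Bool) : History := (a, h.1, h.2.1)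

/-- The digit `a` may follow the history `h`. -/
def History.allows (h : History) (a : Bool) : Bool := windowOk h.2.2 h.2.1 h.1 a

/-- The history preceding the first digit. -/
def History.nil : History := (false, false, false)

/-- Prepend a history to a sequence. -/
def History.prepend (h : History) (e : ℕ → Bool) : ℕ → Bool :=
  consDigit h.2.2 (consDigit h.2.1 (consDigit h.1 e))

/-- Pairs of words of length `m` that may begin two sequences whose values differ by `s`;
branches that die within `n` further digits are discarded. -/
def prefixes (n : ℕ) : ℕ → ℤ × ℤ × ℤ → History → History → List (List (Bool × Bool))
  | 0, s, h, k => if dead n s h k then [] else [[]]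
  | m + 1, s, h, k =>
    if tooBig s then [] else
      [(false, false), (false, true), (true, false), (true, true)].flatMap fun ab =>
        if h.allows ab.1 && k.allows ab.2 then
          (prefixes n m (nextState s ab.1 ab.2) (h.push ab.1) (k.push ab.2)).map (ab :: ·)
        else []
where
  /-- All branches from the given state become too big within `n` digits. -/
  dead : ℕ → ℤ × ℤ × ℤ → History → History → Bool
  | 0, s, _, _ => tooBig s
  | n + 1, s, h, k =>
    tooBig s || [(false, false), (false, true), (true, false), (true, true)].all fun ab =>
      !(h.allows ab.1 && k.allows ab.2) ||
        dead n (nextState s ab.1 ab.2) (h.push ab.1) (k.push ab.2)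

/-- The first `m` digits of two sequences. -/
def jointWord (e f : ℕ → Bool) : ℕ → List (Bool × Bool)
  | 0 => []
  | m + 1 => (e 0, f 0) :: jointWord (tailDigits e) (tailDigits f) m

/-- With `x = |α|²` one has `2 Re α = x - x²`, so the cross terms are polynomials in `x`, reduced
modulo its cubic. -/
theorem normSq_latticeVal {α : ℂ} (hα : α ^ 3 - 2 * α ^ 2 + α - 1 = 0) (hαim : α.im ≠ 0)
    (p q r : ℤ) :
    Complex.normSq (latticeVal α (p, q, r)) = ((p ^ 2 - p * r - q * r : ℤ) : ℝ) +
      ((q ^ 2 + p * q + p * r + 2 * q * r : ℤ) : ℝ) * Complex.normSq α +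
      ((r ^ 2 - p * q - 2 * p * r : ℤ) : ℝ) * Complex.normSq α ^ 2 := by
  have h1 := im_sq_of_root hα hαim
  have h2 := re_cubic_of_root hα hαim
  rw [normSq_of_root hα hαim, Complex.normSq_apply]
  simp [latticeVal, pow_succ]
  linear_combination (r ^ 2 * (α.im ^ 2 + (3 * α.re ^ 2 - 4 * α.re + 1)) -
    2 * r * (p + q * α.re + r * α.re ^ 2) + (q + 2 * r * α.re) ^ 2) * h1 +
    (2 * α.re * p * q + 4 * α.re * p * r + q * r) * h2

/-- The integer test is this norm scaled by `10⁶`, with `x` and `x²` rounded down or up according to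
the sign of their coefficients. -/
theorem lt_normSq_of_tooBig {α : ℂ} (hα : α ^ 3 - 2 * α ^ 2 + α - 1 = 0)
    (hαim : α.im ≠ 0) {s : ℤ × ℤ × ℤ} (hs : tooBig s = true) :
    16.68 < Complex.normSq (latticeVal α s) := by
  obtain ⟨p, q, r⟩ := s
  rw [normSq_latticeVal hα hαim]
  simp only [tooBig, decide_eq_true_eq] at hs
  generalize p ^ 2 - p * r - q * r = A at hs ⊢
  generalize q ^ 2 + p * q + p * r + 2 * q * r = B at hs ⊢
  generalize r ^ 2 - p * q - 2 * p * r = C at hs ⊢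
  have l := normSq_lower hα hαim
  have u := normSq_upper hα hαim
  generalize Complex.normSq α = x at l u ⊢
  have hs' : (16680000 : ℝ) < A * 1000000 + (if 0 ≤ B then (B : ℝ) * 569840 else B * 569841) +
    (if 0 ≤ C then (C : ℝ) * 324717 else C * 324719) := by
    have := (Int.cast_lt (R := ℝ)).2 hs
    split_ifs at this ⊢ <;> push_cast at this <;> exact this
  have hB : (if 0 ≤ B then (B : ℝ) * 569840 else B * 569841) ≤ B * x * 1000000 := by
    split_ifs with h
    · have : (0 : ℝ) ≤ B := by exact_mod_cast h
      nlinarith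
    · have : (B : ℝ) ≤ 0 := by exact_mod_cast (not_le.1 h).le
      nlinarith
  have l2 : 0.324717 ≤ x ^ 2 := by nlinarith
  have u2 : x ^ 2 ≤ 0.324719 := by nlinarith
  have hC : (if 0 ≤ C then (C : ℝ) * 324717 else C * 324719) ≤ C * x ^ 2 * 1000000 := by
    split_ifs with h
    · have : (0 : ℝ) ≤ C := by exact_mod_cast h
      nlinarith
    · have : (C : ℝ) ≤ 0 := by exact_mod_cast (not_le.1 h).le
      nlinarith
  linarith

theorem not_tooBig {α : ℂ} (hα : α ^ 3 - 2 * α ^ 2 + α - 1 = 0) (hαim : α.im ≠ 0)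
    {s : ℤ × ℤ × ℤ} {e f : ℕ → Bool}
    (h : digitSum α e - digitSum α f = latticeVal α s) : tooBig s = false := by
  rw [← Bool.not_eq_true]
  intro hs
  have h1 := lt_normSq_of_tooBig hα hαim hs
  have hn := norm_upper hα hαim
  have h2 := norm_digitSum_sub_le (norm_lt_one_of_root hα hαim) e f
  -- `4.08² = 16.6464` lies below the threshold `16.68`.
  have h3 : (1 - ‖α‖)⁻¹ ≤ 4.08 := by
    rw [inv_le_comm₀ (by linarith) (by norm_num)]
    norm_num at hn ⊢
    linarith
  rw [← h, Complex.normSq_eq_norm_sq] at h1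
  nlinarith [norm_nonneg (digitSum α e - digitSum α f)]

theorem digitSum_tail_sub {α : ℂ} (hα : α ^ 3 - 2 * α ^ 2 + α - 1 = 0) (hαim : α.im ≠ 0)
    {s : ℤ × ℤ × ℤ} {e f : ℕ → Bool}
    (h : digitSum α e - digitSum α f = latticeVal α s) :
    digitSum α (tailDigits e) - digitSum α (tailDigits f) =
      latticeVal α (nextState s (e 0) (f 0)) := by
  have hlt := norm_lt_one_of_root hα hαim
  rw [digitSum_eq hlt e, digitSum_eq hlt f] at h
  apply mul_left_cancel₀ (ne_zero_of_root hα)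
  generalize digitSum α (tailDigits e) = x at h ⊢
  generalize digitSum α (tailDigits f) = y at h ⊢
  obtain ⟨p, q, r⟩ := s
  generalize e 0 = a at h ⊢
  generalize f 0 = b at h ⊢
  have ha : digitVal a = ((a.toNat : ℤ) : ℂ) := by cases a <;> simp
  have hb : digitVal b = ((b.toNat : ℤ) : ℂ) := by cases b <;> simp
  rw [ha, hb] at h
  simp only [latticeVal, nextState] at h ⊢
  push_cast at h ⊢
  linear_combination h - (p - (a.toNat : ℂ) + b.toNat) * hα

theorem History.allows_of_avoiding {h : History} {e : ℕ → Bool}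
    (he : Avoiding (h.prepend e)) : h.allows (e 0) = true := he 0

theorem History.avoiding_push {h : History} {e : ℕ → Bool}
    (he : Avoiding (h.prepend e)) : Avoiding ((h.push (e 0)).prepend (tailDigits e)) := by
  have := he.tail
  simpa only [prepend, push, consDigit_tailDigits, tailDigits_consDigit] using this

theorem Avoiding.prepend_nil {e : ℕ → Bool} (he : Avoiding e) :
    Avoiding (History.nil.prepend e) := he.cons_false.cons_false.cons_false

theorem mem_digitPairs (ab : Bool × Bool) :
    ab ∈ [(false, false), (false, true), (true, false), (true, true)] := by
  revert ab; decide

theorem not_dead {α : ℂ} (hα : α ^ 3 - 2 * α ^ 2 + α - 1 = 0) (hαim : α.im ≠ 0) (n : ℕ)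
    {s : ℤ × ℤ × ℤ} {h k : History} {e f : ℕ → Bool}
    (he : Avoiding (h.prepend e)) (hf : Avoiding (k.prepend f))
    (hs : digitSum α e - digitSum α f = latticeVal α s) : prefixes.dead n s h k = false := by
  induction n generalizing s h k e f with
  | zero => exact not_tooBig hα hαim hs
  | succ n ih =>
    rw [prefixes.dead, not_tooBig hα hαim hs, Bool.false_or, List.all_eq_false]
    refine ⟨(e 0, f 0), mem_digitPairs _, ?_⟩
    rw [History.allows_of_avoiding he, History.allows_of_avoiding hf,
      ih (History.avoiding_push he) (History.avoiding_push hf) (digitSum_tail_sub hα hαim hs)]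
    decide

/-- Soundness of the search: an actual pair of sequences follows a branch that is never cut. -/
theorem jointWord_mem_prefixes {α : ℂ} (hα : α ^ 3 - 2 * α ^ 2 + α - 1 = 0) (hαim : α.im ≠ 0)
    (n m : ℕ) {s : ℤ × ℤ × ℤ} {h k : History} {e f : ℕ → Bool}
    (he : Avoiding (h.prepend e)) (hf : Avoiding (k.prepend f))
    (hs : digitSum α e - digitSum α f = latticeVal α s) :
    jointWord e f m ∈ prefixes n m s h k := by
  induction m generalizing s h k e f with
  | zero => simp [prefixes, jointWord, not_dead hα hαim n he hf hs]
  | succ m ih =>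
    rw [prefixes, not_tooBig hα hαim hs, if_neg Bool.false_ne_true, List.mem_flatMap]
    refine ⟨(e 0, f 0), mem_digitPairs _, ?_⟩
    rw [History.allows_of_avoiding he, History.allows_of_avoiding hf, Bool.and_self,
      if_pos rfl, jointWord]
    exact List.mem_map_of_mem (ih (History.avoiding_push he) (History.avoiding_push hf)
      (digitSum_tail_sub hα hαim hs))

theorem prefix_property {α : ℂ} (hα : α ^ 3 - 2 * α ^ 2 + α - 1 = 0) (hαim : α.im ≠ 0)
    (n m : ℕ) {s : ℤ × ℤ × ℤ} {e f : ℕ → Bool} (he : Avoiding e) (hf : Avoiding f)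
    (hs : digitSum α e - digitSum α f = latticeVal α s) {P : List (Bool × Bool) → Prop}
    (hP : ∀ w ∈ prefixes n m s .nil .nil, P w) : P (jointWord e f m) :=
  hP _ (jointWord_mem_prefixes hα hαim n m he.prepend_nil hf.prepend_nil hs)

/-! ### Periodic expansions -/

/-- The four rotations of the periodic sequence `1100 1100 …`. -/
def cyclicDigits (k n : ℕ) : Bool := decide ((n + k) % 4 < 2)

theorem avoiding_cyclicDigits (k : ℕ) : Avoiding (cyclicDigits k) := by
  intro n
  simp only [windowOk_iff, cyclicDigits, decide_eq_true_eq, decide_eq_false_iff_not]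
  omega

theorem tailDigits_cyclicDigits (k : ℕ) :
    tailDigits (cyclicDigits k) = cyclicDigits (k + 1) := by
  funext n
  simp only [tailDigits_apply, cyclicDigits, show n + 1 + k = n + (k + 1) by ring]

theorem cyclicDigits_four : cyclicDigits 4 = cyclicDigits 0 := by
  funext n
  simp [cyclicDigits]

theorem pow_four_of_root {α : ℂ} (hα : α ^ 3 - 2 * α ^ 2 + α - 1 = 0) :
    α ^ 4 = α ^ 3 + α ^ 2 + 1 := by linear_combination (α + 1) * hα

theorem pow_four_ne_one {α : ℂ} (h : ‖α‖ < 1) : 1 - α ^ 4 ≠ 0 := by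
  intro h0
  have := congrArg norm (sub_eq_zero.1 h0)
  rw [norm_one, norm_pow] at this
  exact (pow_lt_one₀ (norm_nonneg α) h (by norm_num : (4 : ℕ) ≠ 0)).ne' this

/-- The period gives `α² (1 + α) / (1 - α⁴)`, and `α⁴ - 1 = α² + α³`. -/
theorem digitSum_cyclicDigits {α : ℂ} (hα : α ^ 3 - 2 * α ^ 2 + α - 1 = 0) (hαim : α.im ≠ 0) :
    α ^ 2 * digitSum α (cyclicDigits 0) = -1 ∧
    digitSum α (cyclicDigits 1) = 1 + α * digitSum α (cyclicDigits 2) ∧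
    digitSum α (cyclicDigits 2) = α * digitSum α (cyclicDigits 3) ∧
    digitSum α (cyclicDigits 3) = α * digitSum α (cyclicDigits 0) := by
  have h := norm_lt_one_of_root hα hαim
  have h0 := digitSum_eq h (cyclicDigits 0)
  have h1 := digitSum_eq h (cyclicDigits 1)
  have h2 := digitSum_eq h (cyclicDigits 2)
  have h3 := digitSum_eq h (cyclicDigits 3)
  simp only [tailDigits_cyclicDigits, Nat.reduceAdd, cyclicDigits_four,
    show cyclicDigits 0 0 = true from rfl, show cyclicDigits 1 0 = true from rfl,
    show cyclicDigits 2 0 = false from rfl, show cyclicDigits 3 0 = false from rfl,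
    digitVal_true, digitVal_false, zero_add] at h0 h1 h2 h3
  refine ⟨?_, h1, h2, h3⟩
  apply mul_left_cancel₀ (pow_four_ne_one h)
  linear_combination α ^ 2 * h0 + α ^ 3 * h1 + α ^ 4 * h2 + α ^ 5 * h3 - pow_four_of_root hα

/-! ### Intersections as pairs of sequences -/

theorem mem_rauzyRegion_iff {α v z : ℂ} (hα : α ^ 3 - 2 * α ^ 2 + α - 1 = 0)
    (hαim : α.im ≠ 0) {s : ℤ × ℤ × ℤ} (hv : v = α ^ 2 * latticeVal α s) :
    z ∈ rauzyRegion α v ↔ ∃ e f, Avoiding e ∧ Avoiding f ∧ z = α ^ 2 * digitSum α e ∧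
      digitSum α e - digitSum α f = latticeVal α s := by
  have h := norm_lt_one_of_root hα hαim
  have h2 : α ^ 2 ≠ 0 := pow_ne_zero 2 (ne_zero_of_root hα)
  simp only [rauzyRegion, Set.mem_inter_iff, Set.mem_image, mem_rauzyFractal_iff h]
  constructor
  · rintro ⟨⟨e, he, rfl⟩, _, ⟨f, hf, rfl⟩, hef⟩
    refine ⟨e, f, he, hf, rfl, mul_left_cancel₀ h2 ?_⟩
    linear_combination hv - hef
  · rintro ⟨e, f, he, hf, rfl, hef⟩
    refine ⟨⟨e, he, rfl⟩, _, ⟨f, hf, rfl⟩, ?_⟩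
    linear_combination hv - α ^ 2 * hef

theorem mem_rauzyRegion_sub_one_iff {α z : ℂ} (hα : α ^ 3 - 2 * α ^ 2 + α - 1 = 0)
    (hαim : α.im ≠ 0) :
    z ∈ rauzyRegion α (α - 1) ↔ ∃ e f, Avoiding e ∧ Avoiding f ∧ z = α ^ 2 * digitSum α e ∧
      digitSum α e - digitSum α f = latticeVal α (2, -1, 0) := by
  refine mem_rauzyRegion_iff hα hαim ?_
  simp only [latticeVal]
  push_cast
  linear_combination hα

theorem mem_rauzyRegion_inv_sq_add_one_iff {α z : ℂ} (hα : α ^ 3 - 2 * α ^ 2 + α - 1 = 0)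
    (hαim : α.im ≠ 0) :
    z ∈ rauzyRegion α (α ^ (-2 : ℤ) + 1) ↔
      ∃ e f, Avoiding e ∧ Avoiding f ∧ z = α ^ 2 * digitSum α e ∧
      digitSum α e - digitSum α f = latticeVal α (0, 2, -1) := by
  refine mem_rauzyRegion_iff hα hαim ?_
  have hz : α ^ (-2 : ℤ) = α ^ 2 - α - 1 := by
    rw [zpow_neg, zpow_ofNat]
    refine inv_eq_of_mul_eq_one_right ?_
    linear_combination (α + 1) * hα
  simp only [latticeVal, hz]
  push_cast
  linear_combination α * hα

theorem contractingWith_affine {c d : ℂ} (hd : ‖d‖ < 1) :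
    ∃ K, ContractingWith K fun z : ℂ => c + d * z := by
  refine ⟨‖d‖₊, hd, LipschitzWith.of_dist_le_mul fun x y => ?_⟩
  rw [dist_eq_norm, dist_eq_norm, coe_nnnorm, ← norm_mul]
  exact le_of_eq (congrArg norm (by ring))

/-! ### Forced beginnings -/

section

variable {α : ℂ} {e f : ℕ → Bool}

/-- The alternatives correspond in order to the images of `h₀`, `h₁`, `h₂` and to the points
`h₁(-1)` and `h₂(-α - α⁻¹)`. The window condition in the second lets `1` replace the first four
digits of `f`. -/
theorem prefix_cases_two_sub (hα : α ^ 3 - 2 * α ^ 2 + α - 1 = 0) (hαim : α.im ≠ 0)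
    (he : Avoiding e) (hf : Avoiding f)
    (h : digitSum α e - digitSum α f = latticeVal α (2, -1, 0)) :
    jointWord e f 3 = [(true, false), (false, false), (false, true)] ∨
    (jointWord e f 4 = [(true, false), (false, true), (false, true), (false, false)] ∧
      windowOk true (f 4) (f 5) (f 6) = true) ∨
    jointWord e f 4 = [(true, false), (true, true), (false, true), (false, false)] ∨
    jointWord e f 3 = [(true, false), (false, true), (false, false)] ∨
    jointWord e f 5 = [(true, false), (true, true), (false, true), (true, false),
      (false, false)] := by
  have := prefix_property hα hαim 2 7 he hf h (P := fun w =>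
    w.take 3 = [(true, false), (false, false), (false, true)] ∨
    (w.take 4 = [(true, false), (false, true), (false, true), (false, false)] ∧
      windowOk true (w.map Prod.snd)[4]! (w.map Prod.snd)[5]! (w.map Prod.snd)[6]! = true) ∨
    w.take 4 = [(true, false), (true, true), (false, true), (false, false)] ∨
    w.take 3 = [(true, false), (false, true), (false, false)] ∨
    w.take 5 = [(true, false), (true, true), (false, true), (true, false), (false, false)])
    (by decide +kernel)
  exact this

/-- These four digit pairs lead back to the same difference, so the word repeats forever. -/
theorem prefix_lattice_X (hα : α ^ 3 - 2 * α ^ 2 + α - 1 = 0) (hαim : α.im ≠ 0)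
    (he : Avoiding e) (hf : Avoiding f)
    (h : digitSum α e - digitSum α f = latticeVal α (-2, 3, -1)) :
    jointWord e f 4 = [(false, true), (true, false), (true, false), (false, true)] :=
  prefix_property hα hαim 4 4 he hf h
    (P := (· = [(false, true), (true, false), (true, false), (false, true)]))
    (by decide +kernel)

/-- Makes it legitimate to prepend `1` to `f`, as inverting the first step from `2 - α` requires. -/
theorem prefix_lattice_T (hα : α ^ 3 - 2 * α ^ 2 + α - 1 = 0) (hαim : α.im ≠ 0)
    (he : Avoiding e) (hf : Avoiding f)
    (h : digitSum α e - digitSum α f = latticeVal α (0, 2, -1)) :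
    windowOk true (f 0) (f 1) (f 2) = true :=
  prefix_property hα hαim 3 3 he hf h (P := fun w =>
      windowOk true (w.map Prod.snd)[0]! (w.map Prod.snd)[1]! (w.map Prod.snd)[2]! = true)
    (by decide +kernel)

theorem head_of_two_sub (hα : α ^ 3 - 2 * α ^ 2 + α - 1 = 0) (hαim : α.im ≠ 0)
    (he : Avoiding e) (hf : Avoiding f)
    (h : digitSum α e - digitSum α f = latticeVal α (2, -1, 0)) :
    e 0 = true ∧ f 0 = false := by
  have := prefix_property hα hαim 4 1 he hf h (P := (· = [(true, false)])) (by decide +kernel)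
  simpa [jointWord] using this

theorem digitSum_of_lattice_X (hα : α ^ 3 - 2 * α ^ 2 + α - 1 = 0) (hαim : α.im ≠ 0)
    (he : Avoiding e) (hf : Avoiding f)
    (h : digitSum α e - digitSum α f = latticeVal α (-2, 3, -1)) :
    digitSum α e = digitSum α (cyclicDigits 3) := by
  have hlt := norm_lt_one_of_root hα hαim
  refine digitSum_eq_of_selfSimilar hlt (P := fun e => Avoiding e ∧ ∃ f, Avoiding f ∧
    digitSum α e - digitSum α f = latticeVal α (-2, 3, -1)) ?_ ⟨he, f, hf, h⟩
  rintro e ⟨he, f, hf, h⟩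
  have hw := prefix_lattice_X hα hαim he hf h
  simp only [jointWord, List.cons.injEq, Prod.mk.injEq, tailDigits_apply, zero_add,
    Nat.reduceAdd, and_true] at hw
  obtain ⟨⟨e0, f0⟩, ⟨e1, f1⟩, ⟨e2, f2⟩, e3, f3⟩ := hw
  have h1 := digitSum_tail_sub hα hαim h
  have h2 := digitSum_tail_sub hα hαim h1
  have h3 := digitSum_tail_sub hα hαim h2
  have h4 := digitSum_tail_sub hα hαim h3
  simp only [tailDigits_apply, zero_add, Nat.reduceAdd, e0, f0, e1, f1, e2, f2, e3, f3] at h4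
  refine ⟨_, ⟨he.tail.tail.tail.tail, _, hf.tail.tail.tail.tail, h4⟩, ?_⟩
  obtain ⟨c0, c1, c2, c3⟩ := digitSum_cyclicDigits hα hαim
  have E0 := digitSum_eq hlt e
  have E1 := digitSum_eq hlt (tailDigits e)
  have E2 := digitSum_eq hlt (tailDigits (tailDigits e))
  have E3 := digitSum_eq hlt (tailDigits (tailDigits (tailDigits e)))
  simp only [tailDigits_apply, zero_add, Nat.reduceAdd, e0, e1, e2, e3, digitVal_true,
    digitVal_false] at E0 E1 E2 E3
  have hc : α * digitSum α (cyclicDigits 3) = -1 := by linear_combination α * c3 + c0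
  apply mul_left_cancel₀ (ne_zero_of_root hα)
  linear_combination α * (E0 + α * E1 + α ^ 2 * E2 + α ^ 3 * E3) - (1 - α ^ 4) * hc -
    pow_four_of_root hα

end

/-! ### The maps `g`, `h₀`, `h₁`, `h₂` as operations on digits -/

section

variable {α : ℂ}

/-- The pair `(e, f)` becomes `(10f, 00e)`; the exchange of roles absorbs a change of sign of the
difference. -/
theorem mapH0_mem (hα : α ^ 3 - 2 * α ^ 2 + α - 1 = 0) (hαim : α.im ≠ 0) {x : ℂ}
    (hx : x ∈ rauzyRegion α (α - 1)) : mapH0 α x ∈ rauzyRegion α (α - 1) := by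
  have hlt := norm_lt_one_of_root hα hαim
  obtain ⟨e, f, he, hf, rfl, h⟩ := (mem_rauzyRegion_sub_one_iff hα hαim).1 hx
  obtain ⟨-, f0⟩ := head_of_two_sub hα hαim he hf h
  refine (mem_rauzyRegion_sub_one_iff hα hαim).2
    ⟨consDigit true (consDigit false f), consDigit false (consDigit false e),
      hf.cons_false.cons (by simp [windowOk, f0]), he.cons_false.cons_false, ?_, ?_⟩
  all_goals
    simp only [digitSum_cons hlt, mapH0, latticeVal, digitVal_true, digitVal_false] at h ⊢
    push_cast at h ⊢
  · linear_combination α ^ 4 * h + (1 - α ^ 2) * hα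
  · linear_combination -α ^ 2 * h + hα

theorem Avoiding.cons_zero_one_one_zero_tail {e : ℕ → Bool} (he : Avoiding e)
    (e0 : e 0 = true) : Avoiding
      (consDigit false (consDigit true (consDigit true (consDigit false (tailDigits e))))) := by
  have hw : windowOk true false (e 1) (e 2) = true := by
    have := he 0
    rw [windowOk_iff] at this ⊢
    simp_all
  exact ((he.tail.cons_false.cons (by simpa using hw)).cons (by simp [windowOk])).cons_false

/-- The new pair is `(100f, 0110e')` with `e = 1e'`: rewriting by `α⁴ = α³ + α² + 1` cancels the
leading `1` of `e`. -/
theorem mapH1_mem (hα : α ^ 3 - 2 * α ^ 2 + α - 1 = 0) (hαim : α.im ≠ 0) {x : ℂ}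
    (hx : x ∈ rauzyRegion α (α - 1)) : mapH1 α x ∈ rauzyRegion α (α - 1) := by
  have hlt := norm_lt_one_of_root hα hαim
  obtain ⟨e, f, he, hf, rfl, h⟩ := (mem_rauzyRegion_sub_one_iff hα hαim).1 hx
  obtain ⟨e0, -⟩ := head_of_two_sub hα hαim he hf h
  refine (mem_rauzyRegion_sub_one_iff hα hαim).2
    ⟨consDigit true (consDigit false (consDigit false f)),
      consDigit false (consDigit true (consDigit true (consDigit false (tailDigits e)))),
      hf.cons_false.cons_false.cons (by simp [windowOk]),
      he.cons_zero_one_one_zero_tail e0, ?_, ?_⟩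
  all_goals
    have E := digitSum_eq hlt e
    simp only [digitSum_cons hlt, mapH1, latticeVal, digitVal_true, digitVal_false, e0] at h E ⊢
    push_cast at h ⊢
  · linear_combination α ^ 5 * h + (1 + α - α ^ 3) * hα
  · linear_combination -α ^ 3 * h + α ^ 3 * E + (1 + α) * hα

theorem mapH2_mem (hα : α ^ 3 - 2 * α ^ 2 + α - 1 = 0) (hαim : α.im ≠ 0) {x : ℂ}
    (hx : x ∈ rauzyRegion α (α - 1)) : mapH2 α x ∈ rauzyRegion α (α - 1) := by
  have hlt := norm_lt_one_of_root hα hαim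
  obtain ⟨e, f, he, hf, rfl, h⟩ := (mem_rauzyRegion_sub_one_iff hα hαim).1 hx
  obtain ⟨-, f0⟩ := head_of_two_sub hα hαim he hf h
  refine (mem_rauzyRegion_sub_one_iff hα hαim).2
    ⟨consDigit true (consDigit true (consDigit false (consDigit false e))),
      consDigit false (consDigit true (consDigit true (consDigit false f))),
      (he.cons_false.cons_false.cons (by simp [windowOk])).cons (by simp [windowOk]),
      ((hf.cons_false.cons (by simp [windowOk, f0])).cons (by simp [windowOk])).cons_false,
      ?_, ?_⟩
  all_goals
    simp only [digitSum_cons hlt, mapH2, latticeVal, digitVal_true, digitVal_false] at h ⊢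
    push_cast at h ⊢
  · ring
  · linear_combination α ^ 4 * h + (1 - α ^ 2) * hα


/-- The first digits are forced to be `1` and `0`, leaving the difference `-(2α - α²)`; exchanging
the two tails corrects the sign. -/
theorem rauzyRegion_sub_one_eq_image (hα : α ^ 3 - 2 * α ^ 2 + α - 1 = 0) (hαim : α.im ≠ 0) :
    rauzyRegion α (α - 1) = mapG α '' rauzyRegion α (α ^ (-2 : ℤ) + 1) := by
  have hlt := norm_lt_one_of_root hα hαim
  ext z
  constructor
  · intro hz
    obtain ⟨e, f, he, hf, rfl, h⟩ := (mem_rauzyRegion_sub_one_iff hα hαim).1 hz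
    obtain ⟨e0, f0⟩ := head_of_two_sub hα hαim he hf h
    have E := digitSum_eq hlt e
    have F := digitSum_eq hlt f
    simp only [e0, f0, digitVal_true, digitVal_false] at E F
    simp only [latticeVal] at h
    push_cast at h
    refine ⟨α ^ 2 * digitSum α (tailDigits f), ?_, ?_⟩
    · refine (mem_rauzyRegion_inv_sq_add_one_iff hα hαim).2
        ⟨_, _, hf.tail, he.tail, rfl, mul_left_cancel₀ (ne_zero_of_root hα) ?_⟩
      simp only [latticeVal]
      push_cast
      linear_combination E - F - h + hα
    · simp only [mapG]
      linear_combination -α ^ 2 * F - α ^ 2 * h + hα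
  · rintro ⟨w, hw, rfl⟩
    obtain ⟨e, f, he, hf, rfl, h⟩ := (mem_rauzyRegion_inv_sq_add_one_iff hα hαim).1 hw
    refine (mem_rauzyRegion_sub_one_iff hα hαim).2 ⟨consDigit true f, consDigit false e,
      hf.cons (prefix_lattice_T hα hαim he hf h), he.cons_false, ?_, ?_⟩
    all_goals
      simp only [digitSum_cons hlt, mapG, latticeVal, digitVal_true, digitVal_false] at h ⊢
      push_cast at h ⊢
    · linear_combination α ^ 3 * h + (1 - α ^ 2) * hα
    · linear_combination -α * h + hα

theorem neg_one_mem (hα : α ^ 3 - 2 * α ^ 2 + α - 1 = 0) (hαim : α.im ≠ 0) :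
    -1 ∈ rauzyRegion α (α - 1) := by
  obtain ⟨c0, c1, c2, c3⟩ := digitSum_cyclicDigits hα hαim
  refine (mem_rauzyRegion_sub_one_iff hα hαim).2 ⟨_, _, avoiding_cyclicDigits 0,
    avoiding_cyclicDigits 3, c0.symm, mul_left_cancel₀ (pow_ne_zero 2 (ne_zero_of_root hα)) ?_⟩
  simp only [latticeVal]
  push_cast
  linear_combination (1 - α) * c0 - α ^ 2 * c3 + hα

theorem neg_sub_inv_mem (hα : α ^ 3 - 2 * α ^ 2 + α - 1 = 0) (hαim : α.im ≠ 0) :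
    -α - α⁻¹ ∈ rauzyRegion α (α - 1) := by
  obtain ⟨c0, c1, c2, c3⟩ := digitSum_cyclicDigits hα hαim
  have hi : α⁻¹ = α ^ 2 - 2 * α + 1 :=
    inv_eq_of_mul_eq_one_right (by linear_combination hα)
  refine (mem_rauzyRegion_sub_one_iff hα hαim).2 ⟨_, _, avoiding_cyclicDigits 1,
    avoiding_cyclicDigits 2, ?_,
    mul_left_cancel₀ (pow_ne_zero 2 (ne_zero_of_root hα)) ?_⟩
  · rw [hi]
    linear_combination -α ^ 2 * c1 - α ^ 3 * c2 - α ^ 4 * c3 - α ^ 3 * c0 + hα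
  · simp only [latticeVal]
    push_cast
    linear_combination α ^ 2 * c1 - (1 - α) * α ^ 2 * c2 - (1 - α) * α ^ 3 * c3 -
      (1 - α) * α ^ 2 * c0

theorem rauzyRegion_subset_union (hα : α ^ 3 - 2 * α ^ 2 + α - 1 = 0) (hαim : α.im ≠ 0) :
    rauzyRegion α (α - 1) ⊆ mapH0 α '' rauzyRegion α (α - 1) ∪
      mapH1 α '' rauzyRegion α (α - 1) ∪ mapH2 α '' rauzyRegion α (α - 1) := by
  have hlt := norm_lt_one_of_root hα hαim
  have h0 := ne_zero_of_root hα
  intro z hz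
  obtain ⟨e, f, he, hf, rfl, h⟩ := (mem_rauzyRegion_sub_one_iff hα hαim).1 hz
  have hcases := prefix_cases_two_sub hα hαim he hf h
  obtain ⟨c0, c1, c2, c3⟩ := digitSum_cyclicDigits hα hαim
  have h' := h
  simp only [latticeVal] at h
  push_cast at h
  have E0 := digitSum_eq hlt e
  have E1 := digitSum_eq hlt (tailDigits e)
  have E2 := digitSum_eq hlt (tailDigits (tailDigits e))
  have E3 := digitSum_eq hlt (tailDigits (tailDigits (tailDigits e)))
  have F0 := digitSum_eq hlt f
  have F1 := digitSum_eq hlt (tailDigits f)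
  have F2 := digitSum_eq hlt (tailDigits (tailDigits f))
  have F3 := digitSum_eq hlt (tailDigits (tailDigits (tailDigits f)))
  have F4 := digitSum_eq hlt (tailDigits (tailDigits (tailDigits (tailDigits f))))
  simp only [jointWord, List.cons.injEq, Prod.mk.injEq, tailDigits_apply, zero_add,
    Nat.reduceAdd, and_true] at hcases E0 E1 E2 E3 F0 F1 F2 F3 F4
  rcases hcases with ⟨⟨e0, f0⟩, ⟨e1, f1⟩, e2, f2⟩ |
    ⟨⟨⟨e0, f0⟩, ⟨e1, f1⟩, ⟨e2, f2⟩, e3, f3⟩, hw⟩ |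
    ⟨⟨e0, f0⟩, ⟨e1, f1⟩, ⟨e2, f2⟩, e3, f3⟩ |
    ⟨⟨e0, f0⟩, ⟨e1, f1⟩, e2, f2⟩ |
    ⟨⟨e0, f0⟩, ⟨e1, f1⟩, ⟨e2, f2⟩, ⟨e3, f3⟩, e4, f4⟩
  · left; left
    simp only [e0, e1, f0, f1, digitVal_true, digitVal_false] at E0 E1 F0 F1
    refine ⟨α ^ 2 * digitSum α (tailDigits (tailDigits f)),
      (mem_rauzyRegion_sub_one_iff hα hαim).2 ⟨_, _, hf.tail.tail, he.tail.tail, rfl,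
        mul_left_cancel₀ (pow_ne_zero 2 h0) ?_⟩, ?_⟩
    · simp only [latticeVal]
      push_cast
      linear_combination E0 + α * E1 - F0 - α * F1 - h + hα
    · simp only [mapH0]
      linear_combination -α ^ 2 * F0 - α ^ 3 * F1 - α ^ 2 * h + hα
  · left; right
    simp only [e0, e1, e2, e3, f0, f1, f2, f3, digitVal_true, digitVal_false]
      at E0 E1 E2 E3 F0 F1 F2 F3
    refine ⟨α ^ 2 * digitSum α (consDigit true (tailDigits (tailDigits (tailDigits
      (tailDigits f))))), (mem_rauzyRegion_sub_one_iff hα hαim).2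
        ⟨_, _, hf.tail.tail.tail.tail.cons hw, he.tail.tail.tail, rfl,
        mul_left_cancel₀ (pow_ne_zero 3 h0) ?_⟩, ?_⟩
    all_goals
      simp only [latticeVal, mapH1, digitSum_cons hlt, digitVal_true]
    · push_cast
      linear_combination (E0 + α * E1 + α ^ 2 * E2) -
        (F0 + α * F1 + α ^ 2 * F2 + α ^ 3 * F3) - h + (α + 1) * hα
    · linear_combination -α ^ 2 * (F0 + α * F1 + α ^ 2 * F2 + α ^ 3 * F3) - α ^ 2 * h +
        (1 + α + α ^ 2) * hα
  · right
    simp only [e0, e1, e2, e3, f0, f1, f2, f3, digitVal_true, digitVal_false]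
      at E0 E1 E2 E3 F0 F1 F2 F3
    refine ⟨α ^ 2 * digitSum α (tailDigits (tailDigits (tailDigits (tailDigits e)))),
      (mem_rauzyRegion_sub_one_iff hα hαim).2
        ⟨_, _, he.tail.tail.tail.tail, hf.tail.tail.tail.tail, rfl,
        mul_left_cancel₀ (pow_ne_zero 4 h0) ?_⟩, ?_⟩
    · simp only [latticeVal]
      push_cast
      linear_combination h - (E0 + α * E1 + α ^ 2 * E2 + α ^ 3 * E3) +
        (F0 + α * F1 + α ^ 2 * F2 + α ^ 3 * F3) + (α ^ 2 - 1) * hα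
    · simp only [mapH2]
      linear_combination -α ^ 2 * (E0 + α * E1 + α ^ 2 * E2 + α ^ 3 * E3)
  -- Three steps lead to `-2 + 3α - α²`, which determines the tail of `e`.
  · left; right
    refine ⟨-1, neg_one_mem hα hαim, ?_⟩
    have h1 := digitSum_tail_sub hα hαim (digitSum_tail_sub hα hαim (digitSum_tail_sub hα hαim h'))
    simp only [tailDigits_apply, zero_add, Nat.reduceAdd, e0, f0, e1, f1, e2, f2] at h1
    have hx := digitSum_of_lattice_X hα hαim he.tail.tail.tail hf.tail.tail.tail h1
    simp only [e0, e1, e2, digitVal_true, digitVal_false] at E0 E1 E2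
    simp only [mapH1]
    linear_combination -α ^ 2 * (E0 + α * E1 + α ^ 2 * E2 + α ^ 3 * hx) - α ^ 5 * c3 -
      α ^ 4 * c0 + (1 + α) * hα
  -- Five steps lead to the negative of that difference, so the tail of `f` is determined instead.
  · right
    refine ⟨-α - α⁻¹, neg_sub_inv_mem hα hαim, ?_⟩
    have h1 := digitSum_tail_sub hα hαim (digitSum_tail_sub hα hαim (digitSum_tail_sub hα hαim
      (digitSum_tail_sub hα hαim (digitSum_tail_sub hα hαim h'))))
    simp only [tailDigits_apply, zero_add, Nat.reduceAdd, e0, f0, e1, f1, e2, f2, e3, f3,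
      e4, f4] at h1
    have hx := digitSum_of_lattice_X hα hαim hf.tail.tail.tail.tail.tail
      he.tail.tail.tail.tail.tail (by
        rw [← neg_sub, h1]
        simp only [latticeVal, nextState]
        push_cast
        norm_num
        ring)
    have hi : α⁻¹ = α ^ 2 - 2 * α + 1 :=
      inv_eq_of_mul_eq_one_right (by linear_combination hα)
    simp only [f0, f1, f2, f3, f4, digitVal_true, digitVal_false] at F0 F1 F2 F3 F4
    simp only [mapH2, hi]
    linear_combination -α ^ 2 * h - α ^ 2 * (F0 + α * F1 + α ^ 2 * F2 + α ^ 3 * F3 + α ^ 4 * F4) -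
      α ^ 7 * hx - α ^ 7 * c3 - α ^ 6 * c0 +
      α ^ 2 * hα

end

/-! ### Overlaps of the three pieces -/

section

variable {α : ℂ} {e f g : ℕ → Bool}

theorem latticeVal_neg_sub {s t : ℤ × ℤ × ℤ} {x y : ℂ} (h : x - y = latticeVal α s)
    (ht : t = -s := by rfl) : y - x = latticeVal α t := by
  rw [← neg_sub, h, ht]
  simp only [latticeVal, Prod.fst_neg, Prod.snd_neg]
  push_cast
  ring

theorem forced_period_of_pair (hα : α ^ 3 - 2 * α ^ 2 + α - 1 = 0) (hαim : α.im ≠ 0)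
    (he : Avoiding e) (hf : Avoiding f) (hg : Avoiding g)
    (h : digitSum α e - digitSum α f = latticeVal α (2, -1, 0))
    (hk : digitSum α (consDigit false e) - digitSum α g = latticeVal α (-2, 1, 0)) :
    jointWord e f 4 = [(true, false), (true, true), (false, true), (false, false)] ∧
      jointWord (consDigit false e) g 4 =
        [(false, true), (true, true), (true, false), (false, false)] := by
  -- Two searches are glued along the shared sequence `e`, shifted by one in the second.
  have hw := prefix_property hα hαim 3 5 he hf h (P := fun w =>
    ∀ w' ∈ prefixes 3 6 (-2, 1, 0) .nil .nil, w'.map Prod.fst = false :: w.map Prod.fst →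
      (w.take 4 = [(true, false), (true, true), (false, true), (false, false)] ∧
        w'.take 4 = [(false, true), (true, true), (true, false), (false, false)]) ∨
      (w = [(true, false), (true, true), (false, true), (true, false), (false, false)] ∧
        w'.map Prod.snd = [true, false, false, false, true, true])) (by decide +kernel)
    _ (jointWord_mem_prefixes hα hαim 3 6 he.cons_false.prepend_nil hg.prepend_nil hk) rfl
  refine hw.resolve_right ?_
  rintro ⟨hw, hw'⟩
  simp only [jointWord, List.map_cons, List.map_nil, List.cons.injEq, Prod.mk.injEq,
    tailDigits_apply, zero_add, Nat.reduceAdd, and_true] at hw hw'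
  obtain ⟨⟨e0, f0⟩, ⟨e1, f1⟩, ⟨e2, f2⟩, ⟨e3, f3⟩, e4, f4⟩ := hw
  obtain ⟨g0, g1, g2, g3, g4, g5⟩ := hw'
  have h1 := digitSum_tail_sub hα hαim (digitSum_tail_sub hα hαim (digitSum_tail_sub hα hαim
    (digitSum_tail_sub hα hαim (digitSum_tail_sub hα hαim h))))
  simp only [tailDigits_apply, zero_add, Nat.reduceAdd, e0, f0, e1, f1, e2, f2, e3, f3,
    e4, f4] at h1
  -- In the exceptional branch the remainder of `e` must begin with `100`, which the search on the
  -- other difference excludes.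
  have hx := prefix_lattice_X hα hαim hf.tail.tail.tail.tail.tail
    he.tail.tail.tail.tail.tail (latticeVal_neg_sub h1)
  have k1 := digitSum_tail_sub hα hαim (digitSum_tail_sub hα hαim (digitSum_tail_sub hα hαim
    (digitSum_tail_sub hα hαim (digitSum_tail_sub hα hαim (digitSum_tail_sub hα hαim hk)))))
  simp only [tailDigits_consDigit, consDigit_zero, consDigit_one, tailDigits_apply, zero_add, Nat.reduceAdd,
    g0, g1, g2, g3, g4, g5, e0, e1, e2, e3, e4] at k1
  have hy := prefix_property hα hαim 6 3 he.tail.tail.tail.tail.tail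
    hg.tail.tail.tail.tail.tail.tail k1
    (P := fun w => w.map Prod.fst ≠ [true, false, false]) (by decide +kernel)
  apply hy
  simp only [jointWord, List.map_cons, List.map_nil, List.cons.injEq, Prod.mk.injEq,
    tailDigits_apply, zero_add, Nat.reduceAdd, and_true] at hx ⊢
  exact ⟨hx.1.2, hx.2.1.2, hx.2.2.1.2⟩

theorem digitSum_of_triple (hα : α ^ 3 - 2 * α ^ 2 + α - 1 = 0) (hαim : α.im ≠ 0)
    (he : Avoiding e) (hf : Avoiding f) (hg : Avoiding g)
    (h : digitSum α e - digitSum α f = latticeVal α (2, -1, 0))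
    (hk : digitSum α (consDigit false e) - digitSum α g = latticeVal α (-2, 1, 0)) :
    digitSum α e = digitSum α (cyclicDigits 0) := by
  have hlt := norm_lt_one_of_root hα hαim
  refine digitSum_eq_of_selfSimilar hlt (P := fun e => Avoiding e ∧ ∃ f g, Avoiding f ∧
    Avoiding g ∧ digitSum α e - digitSum α f = latticeVal α (2, -1, 0) ∧
    digitSum α (consDigit false e) - digitSum α g = latticeVal α (-2, 1, 0)) ?_
    ⟨he, f, g, hf, hg, h, hk⟩
  rintro e ⟨he, f, g, hf, hg, h, hk⟩
  obtain ⟨hw, hw'⟩ := forced_period_of_pair hα hαim he hf hg h hk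
  simp only [jointWord, List.cons.injEq, Prod.mk.injEq, tailDigits_apply, zero_add,
    Nat.reduceAdd, and_true] at hw hw'
  obtain ⟨⟨e0, f0⟩, ⟨e1, f1⟩, ⟨e2, f2⟩, e3, f3⟩ := hw
  obtain ⟨⟨-, g0⟩, ⟨-, g1⟩, ⟨-, g2⟩, -, g3⟩ := hw'
  have h1 := digitSum_tail_sub hα hαim (digitSum_tail_sub hα hαim (digitSum_tail_sub hα hαim
    (digitSum_tail_sub hα hαim h)))
  simp only [tailDigits_apply, zero_add, Nat.reduceAdd, e0, f0, e1, f1, e2, f2, e3, f3] at h1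
  have k1 := digitSum_tail_sub hα hαim (digitSum_tail_sub hα hαim (digitSum_tail_sub hα hαim
    (digitSum_tail_sub hα hαim hk)))
  have e' : tailDigits (tailDigits (tailDigits (tailDigits (consDigit false e)))) =
      consDigit false (tailDigits (tailDigits (tailDigits (tailDigits e)))) := by
    rw [tailDigits_consDigit, ← consDigit_tailDigits (tailDigits (tailDigits (tailDigits e)))]
    simp only [tailDigits_apply, zero_add, Nat.reduceAdd, e3, tailDigits_consDigit]
  rw [e'] at k1
  simp only [tailDigits_consDigit, consDigit_zero, consDigit_one, tailDigits_apply, zero_add, Nat.reduceAdd,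
    g0, g1, g2, g3, e0, e1, e2] at k1
  refine ⟨_, ⟨he.tail.tail.tail.tail, _, _, hf.tail.tail.tail.tail, hg.tail.tail.tail.tail,
    h1, k1⟩, ?_⟩
  have c0 := (digitSum_cyclicDigits hα hαim).1
  have E0 := digitSum_eq hlt e
  have E1 := digitSum_eq hlt (tailDigits e)
  have E2 := digitSum_eq hlt (tailDigits (tailDigits e))
  have E3 := digitSum_eq hlt (tailDigits (tailDigits (tailDigits e)))
  simp only [tailDigits_apply, zero_add, Nat.reduceAdd, e0, e1, e2, e3, digitVal_true,
    digitVal_false] at E0 E1 E2 E3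
  apply mul_left_cancel₀ (pow_ne_zero 2 (ne_zero_of_root hα))
  linear_combination α ^ 2 * (E0 + α * E1 + α ^ 2 * E2 + α ^ 3 * E3) - (1 - α ^ 4) * c0 -
    pow_four_of_root hα

/-- Comparing the expansions `100f` and `1100e'` of the common point gives `f - αe' = α⁻² = α² - α -
1` in values; one step later the difference is `-2 + 3α - α²`. -/
theorem eq_of_mapH1_eq_mapH2 (hα : α ^ 3 - 2 * α ^ 2 + α - 1 = 0) (hαim : α.im ≠ 0) {x y : ℂ}
    (hx : x ∈ rauzyRegion α (α - 1)) (hy : y ∈ rauzyRegion α (α - 1))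
    (hxy : mapH1 α x = mapH2 α y) : mapH1 α x = -1 - α ^ 2 - α ^ 4 := by
  have hlt := norm_lt_one_of_root hα hαim
  obtain ⟨e, f, he, hf, rfl, h⟩ := (mem_rauzyRegion_sub_one_iff hα hαim).1 hx
  obtain ⟨e', f', he', hf', rfl, h'⟩ := (mem_rauzyRegion_sub_one_iff hα hαim).1 hy
  have hd : digitSum α f - digitSum α (consDigit false e') = latticeVal α (-1, -1, 1) := by
    apply mul_left_cancel₀ (pow_ne_zero 5 (ne_zero_of_root hα))
    simp only [latticeVal, digitSum_cons hlt, digitVal_false, mapH1, mapH2] at h hxy ⊢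
    push_cast at h ⊢
    linear_combination hxy - α ^ 5 * h +
        (-1 - α - α ^ 4) * hα
  have hw := prefix_property hα hαim 1 1 hf he'.cons_false hd (P := (· ≠ [(true, false)]))
    (by decide +kernel)
  have f0 : f 0 = false := by
    rw [← Bool.not_eq_true]
    intro f0
    apply hw
    simp [jointWord, f0]
  have h1 := digitSum_tail_sub hα hαim hd
  simp only [f0, consDigit_zero, tailDigits_consDigit] at h1
  have hv := digitSum_of_lattice_X hα hαim hf.tail he' h1
  have F := digitSum_eq hlt f
  simp only [f0, digitVal_false] at F
  obtain ⟨c0, -, -, c3⟩ := digitSum_cyclicDigits hα hαim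
  simp only [latticeVal, mapH1] at h ⊢
  push_cast at h
  linear_combination α ^ 5 * h + α ^ 5 * F + α ^ 6 * hv + α ^ 6 * c3 + α ^ 5 * c0 +
        (-α ^ 2 - α ^ 3) * hα

/-- A common point would pair `1100e'` with `00e` at difference `2 - α`, but no such pair begins
with `11` against `00`. -/
theorem mapH0_ne_mapH2 (hα : α ^ 3 - 2 * α ^ 2 + α - 1 = 0) (hαim : α.im ≠ 0) {x y : ℂ}
    (hx : x ∈ rauzyRegion α (α - 1)) (hy : y ∈ rauzyRegion α (α - 1)) :
    mapH0 α x ≠ mapH2 α y := by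
  intro hxy
  have hlt := norm_lt_one_of_root hα hαim
  obtain ⟨e, f, he, hf, rfl, h⟩ := (mem_rauzyRegion_sub_one_iff hα hαim).1 hx
  obtain ⟨e', f', he', hf', rfl, h'⟩ := (mem_rauzyRegion_sub_one_iff hα hαim).1 hy
  have hd : digitSum α (consDigit true (consDigit true (consDigit false (consDigit false e')))) -
      digitSum α (consDigit false (consDigit false e)) = latticeVal α (2, -1, 0) := by
    apply mul_left_cancel₀ (pow_ne_zero 2 (ne_zero_of_root hα))
    simp only [latticeVal, digitSum_cons hlt, digitVal_false, digitVal_true, mapH0, mapH2]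
      at hxy ⊢
    push_cast
    linear_combination -hxy +
        hα
  exact prefix_property hα hαim 4 2
    ((he'.cons_false.cons_false.cons (by simp [windowOk])).cons (by simp [windowOk]))
    he.cons_false.cons_false hd (P := (· ≠ [(true, false), (true, false)]))
    (by decide +kernel) rfl

/-- Pairing `10f'` with `0110…` forces the second digit of `f'` to be `0`, so `(e', f')` is in the
`h₀` case. The tail of `f'` then has two partners, as `digitSum_of_triple` requires. -/
theorem eq_of_mapH1_eq_mapH0 (hα : α ^ 3 - 2 * α ^ 2 + α - 1 = 0) (hαim : α.im ≠ 0) {x y : ℂ}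
    (hx : x ∈ rauzyRegion α (α - 1)) (hy : y ∈ rauzyRegion α (α - 1))
    (hxy : mapH1 α x = mapH0 α y) : mapH1 α x = -1 - α ^ 3 := by
  have hlt := norm_lt_one_of_root hα hαim
  obtain ⟨e, f, he, hf, rfl, h⟩ := (mem_rauzyRegion_sub_one_iff hα hαim).1 hx
  obtain ⟨e', f', he', hf', rfl, h'⟩ := (mem_rauzyRegion_sub_one_iff hα hαim).1 hy
  obtain ⟨e0, -⟩ := head_of_two_sub hα hαim he hf h
  obtain ⟨e0', f0'⟩ := head_of_two_sub hα hαim he' hf' h'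
  have E := digitSum_eq hlt e
  simp only [e0, digitVal_true] at E
  have hd : digitSum α (consDigit true (consDigit false f')) -
      digitSum α (consDigit false (consDigit true (consDigit true
        (consDigit false (tailDigits e))))) = latticeVal α (2, -1, 0) := by
    apply mul_left_cancel₀ (pow_ne_zero 2 (ne_zero_of_root hα))
    simp only [latticeVal, digitSum_cons hlt, digitVal_false, digitVal_true, mapH0, mapH1]
      at h' hxy ⊢
    push_cast at h' ⊢
    linear_combination -hxy - α ^ 4 * h' + α ^ 5 * E +
        (α + 2 * α ^ 2) * hα
  have hw := prefix_property hα hαim 4 4 (hf'.cons_false.cons (by simp [windowOk, f0']))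
    (he.cons_zero_one_one_zero_tail e0) hd
    (P := (· ≠ [(true, false), (false, true), (false, true), (true, false)]))
    (by decide +kernel)
  have f1' : f' 1 = false := by
    rw [← Bool.not_eq_true]
    intro hf1
    apply hw
    simp [jointWord, f0', hf1]
  have hcases := prefix_cases_two_sub hα hαim he' hf' h'
  simp only [jointWord, List.cons.injEq, Prod.mk.injEq, tailDigits_apply, zero_add,
    Nat.reduceAdd, and_true, f1', reduceCtorEq, and_false, false_and, or_false] at hcases
  obtain ⟨-, e1', e2', f2'⟩ := hcases
  have hs := digitSum_tail_sub hα hαim (digitSum_tail_sub hα hαim h')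
  simp only [tailDigits_apply, zero_add, e0', f0', e1', f1'] at hs
  have hs' : digitSum α (tailDigits (tailDigits f')) - digitSum α (tailDigits (tailDigits e')) =
    latticeVal α (2, -1, 0) := latticeVal_neg_sub hs
  have E0 := digitSum_eq hlt e'
  have E1 := digitSum_eq hlt (tailDigits e')
  have F0 := digitSum_eq hlt f'
  have F1 := digitSum_eq hlt (tailDigits f')
  simp only [tailDigits_apply, zero_add, e0', e1', f0', f1', digitVal_true, digitVal_false]
    at E0 E1 F0 F1
  have hk : digitSum α (consDigit false (tailDigits (tailDigits f'))) - digitSum α e =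
      latticeVal α (-2, 1, 0) := by
    apply mul_left_cancel₀ (pow_ne_zero 5 (ne_zero_of_root hα))
    simp only [latticeVal, digitSum_cons hlt, digitVal_false, mapH0, mapH1] at h' hxy ⊢
    push_cast at h' ⊢
    linear_combination -hxy - α ^ 4 * h' - α ^ 4 * F0 - α ^ 5 * F1 +
        (α + α ^ 2 - α ^ 3) * hα
  have hv := digitSum_of_triple hα hαim hf'.tail.tail he'.tail.tail he hs' hk
  have c0 := (digitSum_cyclicDigits hα hαim).1
  rw [hxy]
  simp only [latticeVal, mapH0] at h' ⊢
  push_cast at h'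
  linear_combination α ^ 4 * h' + α ^ 4 * F0 + α ^ 5 * F1 + α ^ 6 * hv + α ^ 4 * c0 +
        (-α - α ^ 2) * hα

end

/-! ### Assembly -/

theorem proposition6p1 (α : ℂ) (hα : α ^ 3 - 2 * α ^ 2 + α - 1 = 0) (hαim : α.im ≠ 0) :
    ((∃ K, ContractingWith K (mapH0 α)) ∧ (∃ K, ContractingWith K (mapH1 α)) ∧
      (∃ K, ContractingWith K (mapH2 α))) ∧
    rauzyRegion α (α - 1) = mapG α '' rauzyRegion α (α ^ (-2 : ℤ) + 1) ∧
    rauzyRegion α (α - 1) =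
      mapH0 α '' rauzyRegion α (α - 1) ∪ mapH1 α '' rauzyRegion α (α - 1) ∪
        mapH2 α '' rauzyRegion α (α - 1) ∧
    (mapH1 α '' rauzyRegion α (α - 1) ∩ mapH2 α '' rauzyRegion α (α - 1) =
        {-1 - α ^ 2 - α ^ 4} ∧
      ({-1 - α ^ 2 - α ^ 4} : Set ℂ) = {mapH2 α (-α - α⁻¹)}) ∧
    (mapH1 α '' rauzyRegion α (α - 1) ∩ mapH0 α '' rauzyRegion α (α - 1) = {-1 - α ^ 3} ∧
      ({-1 - α ^ 3} : Set ℂ) = {mapH1 α (-1)}) ∧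
    mapH0 α '' rauzyRegion α (α - 1) ∩ mapH2 α '' rauzyRegion α (α - 1) = ∅ := by
  have hlt := norm_lt_one_of_root hα hαim
  have hpow : ∀ n ≠ 0, ‖α ^ n‖ < 1 := fun n hn => by
    rw [norm_pow]
    exact pow_lt_one₀ (norm_nonneg α) hlt hn
  have hi : α⁻¹ = α ^ 2 - 2 * α + 1 :=
    inv_eq_of_mul_eq_one_right (by linear_combination hα)
  have p2 : mapH2 α (-α - α⁻¹) = -1 - α ^ 2 - α ^ 4 := by
    rw [hi, mapH2]
    linear_combination (-1 - α - α ^ 2 - α ^ 3) * hα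
  -- The overlap points are attained: `-α - α⁻¹` has the same image under `h₁` and `h₂`, and its
  -- image under `h₀` is `h₁(-1)`.
  have p1 : mapH1 α (-α - α⁻¹) = -1 - α ^ 2 - α ^ 4 := by
    rw [hi, mapH1]
    linear_combination (-α ^ 2) * hα
  have r1 : mapH1 α (-1) = -1 - α ^ 3 := by
    rw [mapH1]
    ring
  have r0 : mapH0 α (-α - α⁻¹) = -1 - α ^ 3 := by
    rw [hi, mapH0]
    linear_combination (-α) * hα
  have m1 := neg_one_mem hα hαim
  have m2 := neg_sub_inv_mem hα hαim
  refine ⟨⟨contractingWith_affine (hpow 2 (by norm_num)),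
    contractingWith_affine (hpow 3 (by norm_num)),
    contractingWith_affine (hpow 4 (by norm_num))⟩,
    rauzyRegion_sub_one_eq_image hα hαim, ?_, ⟨?_, by rw [p2]⟩, ⟨?_, by rw [r1]⟩, ?_⟩
  · refine (rauzyRegion_subset_union hα hαim).antisymm ?_
    rintro _ ((⟨x, hx, rfl⟩ | ⟨x, hx, rfl⟩) | ⟨x, hx, rfl⟩)
    · exact mapH0_mem hα hαim hx
    · exact mapH1_mem hα hαim hx
    · exact mapH2_mem hα hαim hx
  · refine Set.Subset.antisymm ?_
      (Set.singleton_subset_iff.2 ⟨⟨_, m2, p1⟩, ⟨_, m2, p2⟩⟩)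
    rintro _ ⟨⟨x, hx, rfl⟩, y, hy, hxy⟩
    exact eq_of_mapH1_eq_mapH2 hα hαim hx hy hxy.symm
  · refine Set.Subset.antisymm ?_
      (Set.singleton_subset_iff.2 ⟨⟨_, m1, r1⟩, ⟨_, m2, r0⟩⟩)
    rintro _ ⟨⟨x, hx, rfl⟩, y, hy, hxy⟩
    exact eq_of_mapH1_eq_mapH0 hα hαim hx hy hxy.symm
  · refine Set.eq_empty_of_forall_notMem ?_
    rintro _ ⟨⟨x, hx, rfl⟩, y, hy, hxy⟩
    exact mapH0_ne_mapH2 hα hαim hx hy hxy.symm
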